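/- All graphs $G=(V,E)$ are simple and connected, not necessarily finite; $d$ is the graph distance, $B_r(v)=\{x\in V: d(v,x)\le r\}$, and $I(u,v)=\{w\in V: d(u,w)+d(w,v)=d(u,v)\}$. A graph $G$ is a *bipartite Helly graph* if it is bipartite and its half-balls (the intersections of a ball $B_r(v)$ with one of the two color classes) have the Helly property: every finite collection of pairwise intersecting non-empty half-balls has a non-empty intersection. A *profile* on a set $V$ is a finite sequence $\pi=(x_1,\dots,x_k)$ of elements of $V$ (repetitions allowed); it is *even* if $k$ is even, and it is a *double-profile* if it is the concatenation $\tau^2=\tau\tau$ of some profile $\tau$ with itself. For $S\subseteq V$, $\pi(S)$ is the number of indices $i$ with $x_i\in S$, and $\pi(v)=\pi(\{v\})$. Let $F_\pi(v)=\sum_{i=1}^k d(v,x_i)$. A *pairing* $P$ of an even profile $\pi$ is a partition of its entries into $k/2$ unordered pairs, and $D_\pi(P)=\sum_{\{a,b\}\in P} d(a,b)$; it is *perfect* if $D_\pi(P)=F_\pi(v)$ for some $v\in V$. The graph $G$ has the *pairing property* if every even profile on $V$ has a perfect pairing, and the *double-pairing property* if every double-profile on $V$ has a perfect pairing. A (simple)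 graph $H$ with vertex set $W$ satisfies the *matching-stable-set property* (respectively, the *double-matching-stable-set property*) if for every even profile (respectively, every double-profile) $\pi$ on $W$ at least one of the following holds: (1) there is a vertex $z$ of $H$ with $\pi(z)>\pi(N_H(z))$; (2) there is a maximal stable set $S$ of $H$ with $\pi(S)>\pi(N_H(S))$; (3) $H$ has a perfect $\pi$-matching, i.e. a multiset of edges of $H$ such that each vertex $v\in W$ belongs to exactly $\pi(v)$ of them. For a vertex $u$ of $G$, the *local graph* $B_u$ has vertex set $B_2(u)$, and two distinct vertices $v,v'\in B_2(u)$ are adjacent in $B_u$ if and only if $u\in I(v,v')$ in $G$. **Proposition.** Let $G=(V,E)$ be a bipartite Helly graph. Then $G$ has the pairing property (respectively, the double-pairing property) if and only if for every $u\in V$ the local graph $B_u$ satisfies the matching-stable-set property (respectively, the double-matching-stable-set property). -/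

import Mathlib

namespace MedianPairing

noncomputable section

variable {V : Type*}

/-- The ball of radius `r` centered at `v`. -/
def ball (G : SimpleGraph V) (v : V) (r : ℕ) : Set V :=
  {x | G.dist v x ≤ r}

/-- The interval `I(u, v)`: all vertices on shortest paths between `u` and `v`. -/
def interval (G : SimpleGraph V) (u v : V) : Set V :=
  {w | G.dist u w + G.dist w v = G.dist u v}

/-- `H` is a half-ball of `G` with respect to the bipartition given by the 2-coloring `c`:
the intersection of a ball with a color class. -/
def IsHalfBall (G : SimpleGraph V) (c : G.Coloring Bool) (H : Set V) : Prop :=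
  ∃ (v : V) (r : ℕ) (i : Bool), H = ball G v r ∩ {x | c x = i}

/-- A family of sets has the Helly property if every finite subfamily of pairwise intersecting
members (each member intersecting itself, i.e. being nonempty) has a nonempty intersection. -/
def HasHellyProperty (F : Set (Set V)) : Prop :=
  ∀ D : Set (Set V), D ⊆ F → D.Finite → (∀ A ∈ D, ∀ B ∈ D, (A ∩ B).Nonempty) → (⋂₀ D).Nonempty

/-- A bipartite Helly graph: a connected bipartite graph whose half-balls have the Helly property
(for a connected graph the bipartition is unique up to exchanging the two classes). -/
def IsBipartiteHelly (G : SimpleGraph V) : Prop :=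
  G.Connected ∧ ∃ c : G.Coloring Bool, HasHellyProperty {H | IsHalfBall G c H}

/-- `F_π(v)`: the sum of the distances from `v` to the entries of the profile `π`. -/
def totalDist (G : SimpleGraph V) (π : List V) (v : V) : ℕ :=
  (π.map fun x => G.dist v x).sum

/-- A pairing of a profile `π`: a partition of the entries of `π` (with multiplicities) into
unordered pairs. -/
def IsPairing (π : List V) (P : Multiset (Sym2 V)) : Prop :=
  (P.map Sym2.toMultiset).sum = (π : Multiset V)

/-- `D(P)`: the sum of the distances `d(a, b)` over the pairs `{a, b}` of `P`. -/
def pairingDist (G : SimpleGraph V) (P : Multiset (Sym2 V)) : ℕ :=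
  (P.map (Sym2.lift ⟨fun a b => G.dist a b, fun _ _ => G.dist_comm⟩)).sum

/-- `P` is a perfect pairing of `π`: strong duality `D(P) = F_π(v)` holds for some vertex `v`. -/
def IsPerfectPairing (G : SimpleGraph V) (π : List V) (P : Multiset (Sym2 V)) : Prop :=
  IsPairing π P ∧ ∃ v : V, pairingDist G P = totalDist G π v

/-- Every profile of even length has a perfect pairing. -/
def PairingProperty (G : SimpleGraph V) : Prop :=
  ∀ π : List V, Even π.length → ∃ P, IsPerfectPairing G π P

/-- Every double-profile `τ² = ττ` has a perfect pairing. -/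
def DoublePairingProperty (G : SimpleGraph V) : Prop :=
  ∀ τ : List V, ∃ P, IsPerfectPairing G (τ ++ τ) P

/-- `π(S)`: the number of entries of the profile `π` lying in `S`. -/
def weight (π : List V) (S : Set V) : ℕ :=
  open scoped Classical in π.countP fun x => x ∈ S

/-- The neighborhood `N(S)` of a set `S` of vertices. -/
def neighborhood (G : SimpleGraph V) (S : Set V) : Set V :=
  {w | ∃ v ∈ S, G.Adj v w}

/-- A perfect `π`-matching of `G`: a multiset of edges of `G` such that every vertex `v` belongs
to exactly `π(v)` of them. -/
def IsPerfectMatching (G : SimpleGraph V) (π : List V) (M : Multiset (Sym2 V)) : Prop :=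
  (∀ e ∈ M, e ∈ G.edgeSet) ∧
    ∀ v : V, open scoped Classical in M.countP (fun e => v ∈ e) = weight π {v}

/-- The three alternatives of the matching-stable-set property for a given profile. -/
def MatchingStableSetCondition (G : SimpleGraph V) (π : List V) : Prop :=
  (∃ z : V, weight π (G.neighborSet z) < weight π {z}) ∨
  (∃ S : Set V, Maximal G.IsIndepSet S ∧ weight π (neighborhood G S) < weight π S) ∨
  ∃ M : Multiset (Sym2 V), IsPerfectMatching G π M

/-- The matching-stable-set property (for all profiles of even length). -/
def MatchingStableSetProperty (G : SimpleGraph V) : Prop :=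
  ∀ π : List V, Even π.length → MatchingStableSetCondition G π

/-- The double-matching-stable-set property (for all double-profiles). -/
def DoubleMatchingStableSetProperty (G : SimpleGraph V) : Prop :=
  ∀ τ : List V, MatchingStableSetCondition G (τ ++ τ)

/-- The local graph `B_u`: its vertices are the vertices of `G` at distance at most 2 from `u`;
distinct `v`, `v'` are adjacent iff `u` lies in the interval `I(v, v')` of `G`. -/
def localGraph (G : SimpleGraph V) (u : V) : SimpleGraph (ball G u 2) where
  Adj v v' := v ≠ v' ∧ u ∈ interval G (v : V) (v' : V)
  symm := ⟨fun v v' h => ⟨h.1.symm, by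
    have h2 : G.dist v u + G.dist u v' = G.dist v v' := h.2
    change G.dist v' u + G.dist u v = G.dist v' v
    rw [G.dist_comm (u := (v' : V)) (v := (v : V)), ← h2, G.dist_comm (u := (v' : V)) (v := u),
      G.dist_comm (u := u) (v := (v : V)), add_comm]⟩⟩
  loopless := ⟨fun _ h => h.1 rfl⟩

end

end MedianPairing

namespace MedianPairing

variable {V : Type*} {G : SimpleGraph V}

/-! Weak duality `IsPairing.pairingDist_le` says D(P) ≤ F(u), with equality iff u lies between the
two entries of every pair. A perfect pairing is therefore a pairing all of whose pairs have a median
u between them.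

Local to global (`exists_perfectPairing`): let u minimize F and project the profile to the ball of
radius 2 around u by `exists_projection`, a consequence of the Helly property under which u is
between two entries iff it is between their images. A perfect matching in the local graph then lifts
to a perfect pairing. A heavy vertex z ≠ u, or a heavy stable set avoiding u, would yield a vertex
with smaller F. If u itself is heavy, all entries can be paired through u.

Global to local (`matchingStableSetCondition`): if u is a median, the pairs of a perfect pairing are
local edges or loops at u, and the loops can be exchanged away unless u is heavy. Otherwise
`exists_totalDist_lt` finds a better w at distance 1 or 2 from u. Distance 1 gives a heavy maximal
stable set, distance 2 makes w a heavy vertex. -/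

/-! ### Distances, parity and consequences of the Helly property -/

/-- A connected graph contains a vertex at each intermediate distance on a geodesic. -/
theorem exists_dist_eq_of_le (hc : G.Connected) (x y : V) (i : ℕ) (hi : i ≤ G.dist x y) :
    ∃ z, G.dist x z = i ∧ G.dist z y + i = G.dist x y := by
  obtain ⟨p, hp⟩ := hc.exists_walk_length_eq_dist x y
  have h1 := G.dist_le (p.take i)
  have h2 := G.dist_le (p.drop i)
  have h3 := hc.dist_triangle (u := x) (v := p.getVert i) (w := y)
  rw [SimpleGraph.Walk.take_length] at h1
  rw [SimpleGraph.Walk.drop_length] at h2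
  exact ⟨p.getVert i, by omega, by omega⟩

theorem coloring_eq_iff_even_dist (hc : G.Connected) (c : G.Coloring Bool) (x y : V) :
    c x = c y ↔ Even (G.dist x y) := by
  obtain ⟨p, hp⟩ := hc.exists_walk_length_eq_dist x y
  rw [← hp, c.even_length_iff_congr p, Bool.eq_iff_iff]

theorem IsBipartiteHelly.dist_mod_two (hG : IsBipartiteHelly G) (x y z : V) :
    G.dist x y % 2 = (G.dist x z + G.dist z y) % 2 := by
  obtain ⟨hc, c, -⟩ := hG
  have h1 := coloring_eq_iff_even_dist hc c x y
  have h2 := coloring_eq_iff_even_dist hc c x z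
  have h3 := coloring_eq_iff_even_dist hc c z y
  rw [Nat.even_iff] at h1 h2 h3
  cases hx : c x <;> cases hy : c y <;> cases hz : c z <;> simp [hx, hy, hz] at h1 h2 h3 <;> omega

/-- The Helly property for balls, restricted to the vertices whose distance to `u` has a
prescribed parity. -/
theorem IsBipartiteHelly.exists_common (hG : IsBipartiteHelly G) (u : V) (b : ℕ)
    (s : Set (V × ℕ)) (hs : s.Finite) (hne : s.Nonempty)
    (h : ∀ p ∈ s, ∀ q ∈ s, ∃ z, G.dist u z % 2 = b ∧ G.dist p.1 z ≤ p.2 ∧ G.dist q.1 z ≤ q.2) :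
    ∃ z, G.dist u z % 2 = b ∧ ∀ p ∈ s, G.dist p.1 z ≤ p.2 := by
  have hmod := hG.dist_mod_two
  obtain ⟨hc, c, hH⟩ := hG
  obtain ⟨p₀, hp₀⟩ := hne
  obtain ⟨z₀, hz₀, -⟩ := h p₀ hp₀ p₀ hp₀
  have key : ∀ z, G.dist u z % 2 = b ↔ c z = c z₀ := by
    intro z
    rw [coloring_eq_iff_even_dist hc, Nat.even_iff]
    have h1 := hmod u z₀ z
    omega
  obtain ⟨z, hz⟩ := hH ((fun p : V × ℕ => ball G p.1 p.2 ∩ {x | c x = c z₀}) '' s)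
    (by rintro _ ⟨p, -, rfl⟩; exact ⟨p.1, p.2, c z₀, rfl⟩) (hs.image _)
    (by
      rintro _ ⟨p, hp, rfl⟩ _ ⟨q, hq, rfl⟩
      obtain ⟨z, h1, h2, h3⟩ := h p hp q hq
      exact ⟨z, ⟨h2, (key z).1 h1⟩, ⟨h3, (key z).1 h1⟩⟩)
  refine ⟨z, (key z).2 ?_, fun p hp => ?_⟩
  · exact (Set.mem_sInter.1 hz _ ⟨p₀, hp₀, rfl⟩).2
  · exact (Set.mem_sInter.1 hz _ ⟨p, hp, rfl⟩).1

/-- Two balls whose radii are smaller than the distances to `u` meet at a vertex of the color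
opposite to `u` whenever `u` is not between the centers. -/
theorem IsBipartiteHelly.exists_between (hG : IsBipartiteHelly G) {u x y : V}
    (h : u ∉ interval G x y) :
    ∃ z, G.dist u z % 2 = 1 ∧ G.dist x z ≤ G.dist u x - 1 ∧ G.dist y z ≤ G.dist u y - 1 := by
  have hc := hG.1
  have hmod := hG.dist_mod_two
  simp only [interval, Set.mem_ofPred_eq] at h
  have h1 := hc.dist_triangle (u := x) (v := u) (w := y)
  have h2 := hmod x y u
  have h3 := hc.dist_triangle (u := u) (v := x) (w := y)
  rw [G.dist_comm (u := x) (v := u)] at h h1 h2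
  -- By parity d(x,y) ≤ d(u,x) + d(u,y) - 2, so the point of an x-y geodesic at distance d(u,x) - 1
  -- from x lies in both balls. If the geodesic is too short for this, y is well inside the ball
  -- around x, and either y or its neighbor towards u has the right color.
  by_cases hle : G.dist u x - 1 ≤ G.dist x y
  · obtain ⟨z, hz1, hz2⟩ := exists_dist_eq_of_le hc x y _ hle
    have h4 := hmod u z x
    have hx : G.dist u x ≠ 0 := fun h0 => by
      rw [hc.dist_eq_zero_iff] at h0
      subst h0
      simp at h
    refine ⟨z, by omega, by omega, ?_⟩
    rw [G.dist_comm]; omega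
  · rcases Nat.mod_two_eq_zero_or_one (G.dist u y) with h0 | h0
    · have hy : G.dist u y ≠ 0 := fun h0 => by
        rw [hc.dist_eq_zero_iff] at h0
        subst h0
        simp [G.dist_comm] at h
      obtain ⟨z, hz1, hz2⟩ := exists_dist_eq_of_le hc y u 1 (by rw [G.dist_comm]; omega)
      have h4 := hc.dist_triangle (u := x) (v := y) (w := z)
      have h5 := hmod u z y
      exact ⟨z, by omega, by omega, by omega⟩
    · exact ⟨y, by omega, by omega, by simp⟩

/-- Finitely many vertices, no two of which (equal or not) have `u` between them, are all seen
from `u` through a common neighbor of `u`. -/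
theorem IsBipartiteHelly.exists_adj_forall (hG : IsBipartiteHelly G) {u : V} {T : Set V}
    (hT : T.Finite) (hne : T.Nonempty) (h : ∀ x ∈ T, ∀ y ∈ T, u ∉ interval G x y) :
    ∃ v, G.dist u v = 1 ∧ ∀ x ∈ T, G.dist v x + 1 = G.dist u x := by
  have hc := hG.1
  have hmod := hG.dist_mod_two
  have hpos : ∀ x ∈ T, G.dist u x ≠ 0 := by
    intro x hx h0
    have := h x hx x hx
    rw [hc.dist_eq_zero_iff] at h0
    subst h0
    simp [interval] at this
  have hu : ∀ x ∈ T, ∃ z, G.dist u z % 2 = 1 ∧ G.dist u z ≤ 1 ∧ G.dist x z ≤ G.dist u x - 1 := by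
    intro x hx
    have := hpos x hx
    obtain ⟨z, hz1, hz2⟩ := exists_dist_eq_of_le hc u x 1 (by omega)
    refine ⟨z, by omega, by omega, ?_⟩
    rw [G.dist_comm]; omega
  -- Odd distance to u together with the ball of radius 1 around u forces a neighbor of u.
  obtain ⟨v, hv1, hv2⟩ := hG.exists_common u 1
    (insert (u, 1) ((fun x => (x, G.dist u x - 1)) '' T)) ((hT.image _).insert _)
    (Set.insert_nonempty _ _) (by
      rintro p (rfl | ⟨x, hx, rfl⟩) q (rfl | ⟨y, hy, rfl⟩)
      · obtain ⟨x, hx⟩ := hne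
        obtain ⟨z, hz⟩ := hu x hx
        exact ⟨z, hz.1, hz.2.1, hz.2.1⟩
      · exact hu y hy
      · obtain ⟨z, hz⟩ := hu x hx
        exact ⟨z, hz.1, hz.2.2, hz.2.1⟩
      · exact hG.exists_between (h x hx y hy))
  have h1 : G.dist u v ≤ 1 := hv2 _ (Set.mem_insert _ _)
  refine ⟨v, by omega, fun x hx => ?_⟩
  have h2 : G.dist x v ≤ G.dist u x - 1 := hv2 _ (Set.mem_insert_of_mem _ ⟨x, hx, rfl⟩)
  have h3 := hpos x hx
  have h4 := hc.dist_triangle (u := u) (v := v) (w := x)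
  rw [G.dist_comm] at h2
  omega

/-- Finitely many neighbors of `u` on geodesics from `u` to `x` have a common neighbor that is
two steps closer to `x` than `u`. -/
theorem IsBipartiteHelly.exists_gate (hG : IsBipartiteHelly G) {u x : V} (hx : 2 ≤ G.dist u x)
    {A : Set V} (hA : A.Finite) (h : ∀ v ∈ A, G.dist u v = 1 ∧ G.dist v x + 1 = G.dist u x) :
    ∃ w, G.dist u w = 2 ∧ G.dist w x + 2 = G.dist u x ∧ ∀ v ∈ A, G.dist v w = 1 := by
  have hc := hG.1
  have hmod := hG.dist_mod_two
  have hgate : ∀ v ∈ A, ∃ z, G.dist u z = 2 ∧ G.dist v z = 1 ∧ G.dist x z ≤ G.dist u x - 2 := by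
    intro v hv
    obtain ⟨h1, h2⟩ := h v hv
    obtain ⟨z, hz1, hz2⟩ := exists_dist_eq_of_le hc v x 1 (by omega)
    have h3 := hc.dist_triangle (u := u) (v := v) (w := z)
    have h4 := hc.dist_triangle (u := u) (v := z) (w := x)
    refine ⟨z, by omega, hz1, ?_⟩
    rw [G.dist_comm]; omega
  obtain ⟨z₀, hz₀, hz₀'⟩ := exists_dist_eq_of_le hc u x 2 hx
  rw [G.dist_comm (u := z₀)] at hz₀'
  obtain ⟨w, hw1, hw2⟩ := hG.exists_common u 0
    (insert (u, 2) (insert (x, G.dist u x - 2) ((fun v => (v, 1)) '' A)))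
    (((hA.image _).insert _).insert _) (Set.insert_nonempty _ _) (by
      rintro p (rfl | rfl | ⟨v, hv, rfl⟩) q (rfl | rfl | ⟨v', hv', rfl⟩)
      · exact ⟨u, by simp⟩
      · exact ⟨z₀, by omega, by simp only; omega, by simp only; omega⟩
      · obtain ⟨z, h1, h2, h3⟩ := hgate v' hv'
        exact ⟨z, by omega, h1.le, h2.le⟩
      · exact ⟨z₀, by omega, by simp only; omega, by simp only; omega⟩
      · exact ⟨z₀, by omega, by simp only; omega, by simp only; omega⟩
      · obtain ⟨z, h1, h2, h3⟩ := hgate v' hv'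
        exact ⟨z, by omega, h3, h2.le⟩
      · obtain ⟨z, h1, h2, h3⟩ := hgate v hv
        exact ⟨z, by omega, h2.le, h1.le⟩
      · obtain ⟨z, h1, h2, h3⟩ := hgate v hv
        exact ⟨z, by omega, h2.le, h3⟩
      · refine ⟨u, by simp, ?_, ?_⟩
        · exact (G.dist_comm.trans (h v hv).1).le
        · exact (G.dist_comm.trans (h v' hv').1).le)
  have h1 : G.dist u w ≤ 2 := hw2 (u, 2) (by simp)
  have h2 : G.dist x w ≤ G.dist u x - 2 := hw2 (x, _) (by simp)
  have h3 := hc.dist_triangle (u := u) (v := w) (w := x)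
  rw [G.dist_comm] at h2
  refine ⟨w, by omega, by omega, fun v hv => ?_⟩
  have h4 : G.dist v w ≤ 1 := hw2 (v, 1) (by simp [hv])
  have h5 := hmod u w v
  have h6 := (h v hv).1
  omega

theorem interval_comm (x y : V) : interval G x y = interval G y x := by
  ext u
  simp only [interval, Set.mem_ofPred_eq]
  rw [G.dist_comm (u := x) (v := u), G.dist_comm (u := u) (v := y), G.dist_comm (u := x) (v := y),
    add_comm]

/-- A finite set of vertices can be projected along geodesics to the ball of radius two around
`u` so that no new pairs with `u` between them arise. -/
theorem IsBipartiteHelly.exists_projection (hG : IsBipartiteHelly G) (u : V) {X : Set V}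
    (hX : X.Finite) :
    ∃ f : V → ball G u 2,
      (∀ x ∈ X, G.dist u (f x) + G.dist (f x : V) x = G.dist u x ∧
        ((f x : V) = x ∨ G.dist u (f x) = 2)) ∧
      ∀ x ∈ X, ∀ y ∈ X, u ∈ interval G (f x : V) (f y : V) → u ∈ interval G x y := by
  have hc := hG.1
  have h1 : ∀ x y : V, ∃ v, u ∉ interval G x y →
      G.dist u v = 1 ∧ G.dist v x + 1 = G.dist u x ∧ G.dist v y + 1 = G.dist u y := by
    intro x y
    by_cases h : u ∈ interval G x y
    · exact ⟨u, fun h' => absurd h h'⟩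
    by_cases hx : u = x
    · subst hx
      exact absurd (by simp [interval]) h
    by_cases hy : u = y
    · subst hy
      exact absurd (by simp [interval]) h
    obtain ⟨v, hv1, hv2⟩ := hG.exists_adj_forall (u := u) (T := {x, y}) (by simp) (by simp) (by
      have hself : ∀ z, u ≠ z → u ∉ interval G z z := by
        intro z hz h0
        simp only [interval, Set.mem_ofPred_eq, SimpleGraph.dist_self] at h0
        exact hz ((hc.dist_eq_zero_iff).1 (by omega))
      rintro a (rfl | rfl) b (rfl | rfl)
      · exact hself _ hx
      · exact h
      · rwa [interval_comm]
      · exact hself _ hy)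
    exact ⟨v, fun _ => ⟨hv1, hv2 x (by simp), hv2 y (by simp)⟩⟩
  choose v hv using h1
  have h2 : ∀ x : V, ∃ w : ball G u 2, (G.dist u w + G.dist (w : V) x = G.dist u x ∧
      ((w : V) = x ∨ G.dist u w = 2)) ∧ ∀ y ∈ X, u ∉ interval G x y →
        G.dist (v x y) w + 1 = G.dist u w ∧ (u ∉ interval G y x →
        G.dist (v y x) w + 1 = G.dist u w) := by
    intro x
    by_cases hx : G.dist u x ≤ 1
    · refine ⟨⟨x, by simp only [ball, Set.mem_ofPred_eq]; omega⟩, ⟨by simp, Or.inl rfl⟩, ?_⟩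
      exact fun y _ h => ⟨(hv x y h).2.1, fun h' => (hv y x h').2.2⟩
    -- The choices `v x y` and `v y x` are unrelated, so the gate is made adjacent to both.
    · obtain ⟨w, hw1, hw2, hw3⟩ := hG.exists_gate (u := u) (x := x) (by omega)
        (A := {a | ∃ y ∈ X, u ∉ interval G x y ∧ (a = v x y ∨ a = v y x)})
        (((hX.image fun y => v x y).union (hX.image fun y => v y x)).subset (by
          rintro a ⟨y, hy, -, rfl | rfl⟩
          · exact Or.inl ⟨y, hy, rfl⟩
          · exact Or.inr ⟨y, hy, rfl⟩)) (by
          rintro a ⟨y, hy, hu, rfl | rfl⟩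
          · exact ⟨(hv x y hu).1, (hv x y hu).2.1⟩
          · rw [interval_comm] at hu
            exact ⟨(hv y x hu).1, (hv y x hu).2.2⟩)
      refine ⟨⟨w, hw1.le⟩, ⟨by simp only; omega, Or.inr hw1⟩, fun y hy h => ⟨?_, fun _ => ?_⟩⟩
      · simp only [hw1, hw3 _ ⟨y, hy, h, Or.inl rfl⟩]
      · simp only [hw1, hw3 _ ⟨y, hy, h, Or.inr rfl⟩]
  choose f hf using h2
  refine ⟨f, fun x _ => (hf x).1, fun x hx y hy hu => ?_⟩
  by_contra hn
  have h3 := ((hf x).2 y hy hn).1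
  -- The images of x and y are both closer to `v x y` than to u, so a path through `v x y` beats the
  -- one through u.
  have hn' := hn
  rw [interval_comm] at hn'
  have h4 := ((hf y).2 x hx hn').2 hn
  have h5 := hc.dist_triangle (u := (f x : V)) (v := v x y) (w := (f y : V))
  simp only [interval, Set.mem_ofPred_eq] at hu
  rw [G.dist_comm (u := (f x : V)) (v := u)] at hu
  rw [G.dist_comm (u := (f x : V)) (v := v x y)] at h5
  omega

/-! ### Pairings, weights and weak duality -/

theorem toMultiset_mk {α : Type*} (a b : α) : (s(a, b) : Sym2 α).toMultiset = {a, b} := rfl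

/-- Pairings lift along maps of profiles. -/
theorem exists_lift_pairing {α β : Type*} (f : α → β) (P : Multiset (Sym2 β)) :
    ∀ s : Multiset α, (P.map Sym2.toMultiset).sum = s.map f →
      ∃ Q : Multiset (Sym2 α), (Q.map Sym2.toMultiset).sum = s ∧ Q.map (Sym2.map f) = P := by
  classical
  induction P using Multiset.induction with
  | empty =>
    intro s hs
    simp only [Multiset.map_zero, Multiset.sum_zero] at hs
    exact ⟨0, by simpa using (Multiset.map_eq_zero.1 hs.symm).symm, by simp⟩
  | cons e P ih =>
    induction e using Sym2.ind with | _ a b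
    intro s hs
    rw [Multiset.map_cons, Multiset.sum_cons, toMultiset_mk] at hs
    have hs' : s.map f = a ::ₘ (b ::ₘ (P.map Sym2.toMultiset).sum) := by
      rw [← hs]; simp
    obtain ⟨x, hx, rfl, h1⟩ := (Multiset.map_eq_cons f s _ a).2 hs'
    obtain ⟨y, hy, rfl, h2⟩ := (Multiset.map_eq_cons f _ _ b).2 h1
    obtain ⟨Q, hQ1, hQ2⟩ := ih _ h2.symm
    refine ⟨s(x, y) ::ₘ Q, ?_, by simp [hQ2]⟩
    rw [Multiset.map_cons, Multiset.sum_cons, toMultiset_mk, hQ1]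
    rw [Multiset.insert_eq_cons, Multiset.cons_add, Multiset.singleton_add,
      Multiset.cons_erase hy, Multiset.cons_erase hx]

/-- In a multiset of non-loops, the number of pairs through a vertex is its multiplicity in the
underlying multiset of vertices. -/
theorem countP_mem_eq_count {α : Type*} [DecidableEq α] (v : α) (M : Multiset (Sym2 α))
    (hM : ∀ e ∈ M, ¬ e.IsDiag) (inst : DecidablePred fun e : Sym2 α => v ∈ e) :
    M.countP (fun e => v ∈ e) = (M.map Sym2.toMultiset).sum.count v := by
  induction M using Multiset.induction with
  | empty => simp
  | cons e M ih =>
    rw [Multiset.countP_cons, ih fun e he => hM e (Multiset.mem_cons_of_mem he)]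
    rw [Multiset.map_cons, Multiset.sum_cons, Multiset.count_add, add_comm]
    congr 1
    have he := hM e (Multiset.mem_cons_self _ _)
    induction e using Sym2.ind with | _ a b
    rw [Sym2.mk_isDiag_iff] at he
    rw [toMultiset_mk]
    by_cases h1 : v = a
    · subst h1
      simp [he]
    · by_cases h2 : v = b
      · subst h2
        simp [h1]
      · simp [h1, h2]

theorem weight_eq_countP (π : List V) (S : Set V) [inst : DecidablePred (· ∈ S)] :
    weight π S = π.countP fun x => x ∈ S := by
  unfold weight
  congr!

theorem weight_singleton [DecidableEq V] (π : List V) (v : V) : weight π {v} = π.count v := by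
  classical
  rw [weight_eq_countP, List.count]
  congr! 2 with x

theorem weight_compl (π : List V) (S : Set V) : weight π S + weight π Sᶜ = π.length := by
  classical
  rw [weight_eq_countP, weight_eq_countP, List.length_eq_countP_add_countP (fun x => x ∈ S)]
  congr! 3 with x
  simp

theorem weight_mono (π : List V) {S T : Set V} (h : ∀ x ∈ π, x ∈ S → x ∈ T) :
    weight π S ≤ weight π T := by
  classical
  rw [weight_eq_countP, weight_eq_countP]
  exact List.countP_mono_left (by simpa using h)

theorem weight_map {W : Type*} (f : V → W) (π : List V) (S : Set W) :
    weight (π.map f) S = weight π (f ⁻¹' S) := by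
  classical
  rw [weight_eq_countP, weight_eq_countP, List.countP_map]
  rfl

theorem IsPerfectMatching.isPairing {π : List V} {M : Multiset (Sym2 V)}
    (h : IsPerfectMatching G π M) : IsPairing π M := by
  classical
  refine Multiset.ext.2 fun v => ?_
  rw [← countP_mem_eq_count v M (fun e he => G.not_isDiag_of_mem_edgeSet (h.1 e he)), h.2 v,
    weight_singleton, Multiset.coe_count]

theorem IsPairing.isPerfectMatching {π : List V} {M : Multiset (Sym2 V)} (h : IsPairing π M)
    (hM : ∀ e ∈ M, e ∈ G.edgeSet) : IsPerfectMatching G π M := by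
  classical
  refine ⟨hM, fun v => ?_⟩
  rw [countP_mem_eq_count v M (fun e he => G.not_isDiag_of_mem_edgeSet (hM e he)),
    weight_singleton, ← Multiset.coe_count]
  exact congrArg _ h

/-- Entrywise bookkeeping for every median comparison: a gain of k on A against a loss of at most k
on B turns a comparison of the two weights into one of the two distance sums. -/
theorem sum_map_add_mul_weight_le (π : List V) (g h : V → ℕ) (k : ℕ) (A B : Set V)
    (H : ∀ x ∈ π, (x ∈ A → x ∉ B → g x + k ≤ h x) ∧ (x ∉ A → x ∈ B → g x ≤ h x + k) ∧
      ((x ∈ A ↔ x ∈ B) → g x ≤ h x)) :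
    (π.map g).sum + k * weight π A ≤ (π.map h).sum + k * weight π B := by
  classical
  rw [weight_eq_countP, weight_eq_countP]
  induction π with
  | nil => simp
  | cons x π ih =>
    have h1 := ih fun y hy => H y (List.mem_cons_of_mem _ hy)
    have h2 := H x List.mem_cons_self
    simp only [List.map_cons, List.sum_cons, List.countP_cons, mul_add, decide_eq_true_eq]
    split_ifs <;> simp_all <;> omega

/-- Weak duality for pairings, with the description of equality. -/
theorem IsPairing.pairingDist_le (hc : G.Connected) {π : List V} {P : Multiset (Sym2 V)}
    (hP : IsPairing π P) (u : V) :
    pairingDist G P ≤ totalDist G π u ∧ (pairingDist G P = totalDist G π u ↔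
      ∀ a b, s(a, b) ∈ P → u ∈ interval G a b) := by
  have h1 : totalDist G π u = ((P.map Sym2.toMultiset).sum.map fun x => G.dist u x).sum := by
    rw [hP, totalDist, Multiset.map_coe, Multiset.sum_coe]
  rw [h1]
  clear h1 hP
  induction P using Multiset.induction with
  | empty => simp [pairingDist]
  | cons e P ih =>
    induction e using Sym2.ind with | _ a b
    have h2 : pairingDist G (s(a, b) ::ₘ P) = G.dist a b + pairingDist G P := by
      simp [pairingDist]
    have h3 : (((s(a, b) ::ₘ P).map Sym2.toMultiset).sum.map fun x => G.dist u x).sum =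
        G.dist a u + G.dist u b + ((P.map Sym2.toMultiset).sum.map fun x => G.dist u x).sum := by
      rw [Multiset.map_cons, Multiset.sum_cons, toMultiset_mk, Multiset.map_add, Multiset.sum_add,
        G.dist_comm (u := a)]
      simp
    have h4 := hc.dist_triangle (u := a) (v := u) (w := b)
    rw [h2, h3]
    refine ⟨by omega, fun h a' b' hab => ?_, fun h => ?_⟩
    · rcases Multiset.mem_cons.1 hab with h5 | h5
      · have h6 : u ∈ interval G a b := by
          simp only [interval, Set.mem_ofPred_eq]
          omega
        rcases Sym2.eq_iff.1 h5 with ⟨rfl, rfl⟩ | ⟨rfl, rfl⟩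
        · exact h6
        · rwa [interval_comm]
      · exact ih.2.1 (by omega) a' b' h5
    · have h5 : G.dist a u + G.dist u b = G.dist a b := h a b (Multiset.mem_cons_self _ _)
      have h6 := ih.2.2 fun a' b' hab => h a' b' (Multiset.mem_cons_of_mem hab)
      omega

/-- If `u` fills at least half of an even profile, then the profile can be paired so that `u`
lies in each pair. -/
theorem exists_pairing_through (π : List V) (hπ : Even π.length) (u : V)
    (h : weight π {u}ᶜ ≤ weight π {u}) : ∃ P, IsPairing π P ∧ ∀ e ∈ P, u ∈ e := by
  classical
  have h1 := weight_compl π {u}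
  obtain ⟨m, hm⟩ : ∃ m, weight π {u} = weight π {u}ᶜ + 2 * m := by
    obtain ⟨k, hk⟩ := hπ
    exact ⟨k - weight π {u}ᶜ, by omega⟩
  refine ⟨((π : Multiset V).filter (· ≠ u)).map (fun x => s(u, x)) +
    Multiset.replicate m s(u, u), ?_, ?_⟩
  · have h2 : ∀ s : Multiset V, ((s.map fun x => s(u, x)).map Sym2.toMultiset).sum =
        Multiset.replicate s.card u + s := by
      intro s
      induction s using Multiset.induction with
      | empty => simp
      | cons a s ih =>
        rw [Multiset.map_cons, Multiset.map_cons, Multiset.sum_cons, ih, toMultiset_mk,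
          Multiset.card_cons, Multiset.replicate_succ]
        simp [Multiset.cons_swap]
    have h3 : ((π : Multiset V).filter (· ≠ u)).card = weight π {u}ᶜ := by
      rw [← Multiset.countP_eq_card_filter, weight_eq_countP, Multiset.coe_countP]
      rfl
    rw [IsPairing, Multiset.map_add, Multiset.sum_add, h2, h3]
    rw [Multiset.map_replicate, Multiset.sum_replicate, toMultiset_mk]
    refine Multiset.ext.2 fun v => ?_
    by_cases hv : v = u
    · subst hv
      rw [weight_singleton] at hm
      simp [hm]
      omega
    · simp [Multiset.count_replicate, hv, Ne.symm hv]
  · intro e he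
    rcases Multiset.mem_add.1 he with he | he
    · obtain ⟨x, -, rfl⟩ := Multiset.mem_map.1 he
      simp
    · rw [Multiset.eq_of_mem_replicate he]
      simp

/-- A pairing whose pairs are edges or repetitions of a dominating vertex `u` can be turned into
a perfect matching unless `u` outweighs its neighborhood. -/
theorem exists_perfectMatching_of_pairing {π : List V} {u : V} (hu : ∀ x, x ≠ u → G.Adj u x)
    (hw : weight π {u} ≤ weight π {u}ᶜ) (P : Multiset (Sym2 V)) (hP : IsPairing π P)
    (he : ∀ e ∈ P, e ∈ G.edgeSet ∨ e = s(u, u)) : ∃ M, IsPerfectMatching G π M := by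
  classical
  induction hn : P.count s(u, u) generalizing P with
  | zero =>
    refine ⟨P, hP.isPerfectMatching fun e h => (he e h).resolve_right ?_⟩
    rintro rfl
    exact Multiset.count_eq_zero.1 hn h
  | succ n ih =>
    obtain ⟨P, rfl⟩ := Multiset.exists_cons_of_mem (a := s(u, u))
      (Multiset.count_pos.1 (by omega : 0 < P.count s(u, u)))
    rw [Multiset.count_cons_self] at hn
    have hP' : u ::ₘ u ::ₘ (P.map Sym2.toMultiset).sum = π := by
      rw [← hP, Multiset.map_cons, Multiset.sum_cons, toMultiset_mk]
      simp
    -- If every other pair contains u, the extra loop makes u strictly outweigh the rest. Otherwise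
    -- a pair {a, b} avoiding u is exchanged with the loop to give {u, a} and {u, b}.
    by_cases hall : ∀ e ∈ P, u ∈ e
    · exfalso
      have h1 : ∀ P : Multiset (Sym2 V), (∀ e ∈ P, u ∈ e) →
          (P.map Sym2.toMultiset).sum.countP (· ≠ u) ≤ (P.map Sym2.toMultiset).sum.count u := by
        intro P hall
        induction P using Multiset.induction with
        | empty => simp
        | cons e P ih =>
          have h2 := ih fun e he => hall e (Multiset.mem_cons_of_mem he)
          obtain ⟨x, rfl⟩ := hall e (Multiset.mem_cons_self _ _)
          rw [Multiset.map_cons, Multiset.sum_cons, toMultiset_mk, Multiset.countP_add,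
            Multiset.count_add]
          refine add_le_add ?_ h2
          by_cases hx : x = u
          · subst hx
            simpa using Multiset.countP_le_card _ ({x} : Multiset V) |>.trans (by simp)
          · simpa [Ne.symm hx] using Multiset.countP_le_card _ ({x} : Multiset V)
      have h2 := h1 P hall
      rw [weight_singleton, weight_eq_countP, ← Multiset.coe_count,
        ← Multiset.coe_countP, ← hP'] at hw
      simp at hw h2
      omega
    · push Not at hall
      obtain ⟨e, heP, hue⟩ := hall
      obtain ⟨P, rfl⟩ := Multiset.exists_cons_of_mem heP
      induction e using Sym2.ind with | _ a b
      have ha : a ≠ u := by rintro rfl; simp at hue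
      have hb : b ≠ u := by rintro rfl; simp at hue
      have hua : s(u, u) ≠ s(u, a) := by simp [ha.symm]
      have hub : s(u, u) ≠ s(u, b) := by simp [hb.symm]
      have huab : s(u, u) ≠ s(a, b) := by simp [ha.symm]
      refine ih (s(u, a) ::ₘ s(u, b) ::ₘ P) ?_ ?_ ?_
      · rw [IsPairing, ← hP']
        simp only [Multiset.map_cons, Multiset.sum_cons, toMultiset_mk, Multiset.insert_eq_cons,
          Multiset.cons_add, Multiset.singleton_add]
        rw [Multiset.cons_swap a u]
      · intro e h
        rcases Multiset.mem_cons.1 h with rfl | h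
        · exact Or.inl (hu a ha)
        rcases Multiset.mem_cons.1 h with rfl | h
        · exact Or.inl (hu b hb)
        exact he e (Multiset.mem_cons_of_mem (Multiset.mem_cons_of_mem h))
      · rw [Multiset.count_cons_of_ne hua, Multiset.count_cons_of_ne hub]
        rw [Multiset.count_cons_of_ne huab] at hn
        omega

/-! ### Stable sets and intervals in the local graph -/

theorem neighborhood_eq_compl {S : Set V} (hS : Maximal G.IsIndepSet S) :
    neighborhood G S = Sᶜ := by
  ext w
  constructor
  · rintro ⟨v, hv, hvw⟩ hw
    exact hS.prop hv hw hvw.ne hvw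
  · intro hw
    by_contra hn
    have hins : G.IsIndepSet (insert w S) := by
      refine Set.Pairwise.insert hS.prop fun b hb _ => ⟨fun h => ?_, fun h => ?_⟩
      · exact hn ⟨b, hb, h.symm⟩
      · exact hn ⟨b, hb, h⟩
    exact hw (hS.le_of_ge hins (Set.subset_insert _ _) (Set.mem_insert _ _))

theorem self_mem_ball (u : V) (r : ℕ) : u ∈ ball G u r := by simp [ball]

theorem localGraph_adj_center (u : V) {x : ball G u 2} (hx : x ≠ ⟨u, self_mem_ball u 2⟩) :
    (localGraph G u).Adj ⟨u, self_mem_ball u 2⟩ x :=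
  ⟨hx.symm, by simp [interval]⟩

theorem localGraph_neighborSet_center (u : V) :
    (localGraph G u).neighborSet ⟨u, self_mem_ball u 2⟩ = {⟨u, self_mem_ball u 2⟩}ᶜ := by
  ext x
  exact ⟨fun h => ((localGraph G u).mem_neighborSet _ _ |>.1 h).ne', fun h => localGraph_adj_center u h⟩

theorem localGraph_eq_singleton_of_center_mem {u : V} {S : Set (ball G u 2)}
    (hS : (localGraph G u).IsIndepSet S) (hu : ⟨u, self_mem_ball u 2⟩ ∈ S) :
    S = {⟨u, self_mem_ball u 2⟩} := by
  refine Set.eq_singleton_iff_unique_mem.2 ⟨hu, fun x hx => ?_⟩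
  by_contra hn
  exact hS hu hx (Ne.symm hn) (localGraph_adj_center u hn)

theorem eq_of_mem_interval_self (hc : G.Connected) {u x : V} (h : u ∈ interval G x x) :
    x = u := by
  simp only [interval, Set.mem_ofPred_eq, SimpleGraph.dist_self] at h
  exact hc.dist_eq_zero_iff.1 (by omega)

/-- Shortening both ends of a geodesic through u towards u keeps u between them; this is the
direction of the projection that needs no Helly property. -/
theorem mem_interval_of_mem_interval (hc : G.Connected) {u x y x' y' : V}
    (hx : G.dist u x' + G.dist x' x = G.dist u x) (hy : G.dist u y' + G.dist y' y = G.dist u y)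
    (h : u ∈ interval G x y) : u ∈ interval G x' y' := by
  simp only [interval, Set.mem_ofPred_eq] at h ⊢
  have h1 := hc.dist_triangle (u := x) (v := x') (w := y)
  have h2 := hc.dist_triangle (u := x') (v := y') (w := y)
  have h3 := hc.dist_triangle (u := x') (v := u) (w := y')
  rw [G.dist_comm (u := x) (v := x')] at h1
  rw [G.dist_comm (u := x) (v := u)] at h
  rw [G.dist_comm (u := x') (v := u)] at h3 ⊢
  omega

theorem IsPairing.mem_of_mem_pair {π : List V} {P : Multiset (Sym2 V)} (hP : IsPairing π P) {e : Sym2 V}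
    (he : e ∈ P) {a : V} (ha : a ∈ e) : a ∈ π := by
  rw [← Multiset.mem_coe, ← hP]
  exact Multiset.mem_of_le (Multiset.single_le_sum (fun _ _ => Multiset.zero_le _) _
    (Multiset.mem_map_of_mem _ he)) (Sym2.mem_toMultiset.2 ha)

/-! ### From the local condition to perfect pairings -/

/-- At a median of an even profile, the matching-stable-set condition for the projected profiles
yields a perfect pairing. -/
theorem IsBipartiteHelly.exists_perfectPairing (hG : IsBipartiteHelly G) {π : List V}
    (hπ : Even π.length)
    (h : ∀ (u : V) (f : V → ball G u 2), MatchingStableSetCondition (localGraph G u) (π.map f)) :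
    ∃ P, IsPerfectPairing G π P := by
  have hc := hG.1
  have hmod := hG.dist_mod_two
  have : Nonempty V := hc.nonempty
  -- F takes natural values, so a median exists even in an infinite graph.
  obtain ⟨u, hu⟩ : ∃ u, ∀ v, totalDist G π u ≤ totalDist G π v :=
    ⟨Function.argmin (totalDist G π), fun v => Function.argmin_le _ v⟩
  obtain ⟨f, hf, hfi⟩ := hG.exists_projection u (X := {x | x ∈ π}) π.finite_toSet
  suffices hP : ∃ P, IsPairing π P ∧ ∀ a b, s(a, b) ∈ P → u ∈ interval G a b by
    obtain ⟨P, hP, hPu⟩ := hP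
    exact ⟨P, hP, u, (hP.pairingDist_le hc u).2.2 hPu⟩
  have hcenter : weight (π.map f) {⟨u, self_mem_ball u 2⟩}ᶜ <
      weight (π.map f) {⟨u, self_mem_ball u 2⟩} →
      ∃ P, IsPairing π P ∧ ∀ a b, s(a, b) ∈ P → u ∈ interval G a b := by
    intro hlt
    have h1 := weight_compl (π.map f) {⟨u, self_mem_ball u 2⟩}
    have h2 := weight_compl π {u}
    rw [List.length_map] at h1
    -- Only u projects to u: every other entry stays fixed or lands at distance 2.
    have h3 : weight (π.map f) {⟨u, self_mem_ball u 2⟩} ≤ weight π {u} := by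
      rw [weight_map]
      refine weight_mono π fun x hx hxu => ?_
      have h4 : (f x : V) = u := congrArg Subtype.val hxu
      rcases (hf x hx).2 with h5 | h5
      · exact h5.symm.trans h4
      · rw [h4] at h5
        simp at h5
    obtain ⟨P, hP, hPu⟩ := exists_pairing_through π hπ u (by omega)
    refine ⟨P, hP, fun a b hab => ?_⟩
    rcases Sym2.mem_iff.1 (hPu _ hab) with rfl | rfl <;> simp [interval]
  rcases h u f with ⟨z, hz⟩ | ⟨S, hS, hw⟩ | ⟨M, hM⟩
  · by_cases hzu : z = ⟨u, self_mem_ball u 2⟩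
    · subst hzu
      rw [localGraph_neighborSet_center] at hz
      exact hcenter hz
    · exfalso
      have hz2 : G.dist u z ≤ 2 := z.2
      have hpos : 0 < G.dist u z := hc.pos_dist_of_ne fun h0 => hzu (Subtype.ext h0.symm)
      rw [weight_map, weight_map] at hz
      -- Moving from u to z gains d(u,z) on entries projected to z and loses at most d(u,z) on those
      -- projected to neighbors of z. For the rest u is not between z and x, so parity saves 2,
      -- which absorbs d(u,z) ≤ 2.
      have h1 := sum_map_add_mul_weight_le π (fun x => G.dist z x) (fun x => G.dist u x)
        (G.dist u z) (f ⁻¹' {z}) (f ⁻¹' (localGraph G u).neighborSet z) (by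
          intro x hx
          have h2 := (hf x hx).1
          have h3 := hc.dist_triangle (u := (z : V)) (v := u) (w := x)
          rw [G.dist_comm (u := (z : V)) (v := u)] at h3
          refine ⟨fun h4 _ => ?_, fun _ _ => by omega, fun h4 => ?_⟩
          · rw [show f x = z from h4] at h2
            omega
          · by_cases h5 : f x = z
            · exact absurd h5.symm ((localGraph G u).mem_neighborSet z (f x) |>.1 (h4.1 h5)).ne
            · have h6 : u ∉ interval G (z : V) x := fun h6 => h5 (h4.2
                ⟨Ne.symm h5, mem_interval_of_mem_interval hc (by simp) h2 h6⟩)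
              simp only [interval, Set.mem_ofPred_eq] at h6
              rw [G.dist_comm (u := (z : V)) (v := u)] at h6
              have h7 := hmod z x u
              rw [G.dist_comm (u := (z : V)) (v := u)] at h7
              omega)
      have h2 : totalDist G π u ≤ totalDist G π z := hu z
      have h3 := Nat.mul_lt_mul_of_pos_left hz hpos
      simp only [totalDist] at h2
      omega
  · by_cases hcS : ⟨u, self_mem_ball u 2⟩ ∈ S
    · rw [neighborhood_eq_compl hS, localGraph_eq_singleton_of_center_mem hS.prop hcS] at hw
      exact hcenter hw
    · exfalso
      rw [neighborhood_eq_compl hS, weight_map, weight_map] at hw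
      -- Stability of S gives one neighbor v of u closer to all entries projected into S; as these
      -- are the majority, moving to v lowers F.
      obtain ⟨v, hv1, hv2⟩ := hG.exists_adj_forall (u := u) (T := {x | x ∈ π ∧ f x ∈ S})
        (π.finite_toSet.subset fun x hx => hx.1) (by
          by_contra hne
          have h1 := weight_mono π (S := f ⁻¹' S) (T := f ⁻¹' Sᶜ) fun x hx hxS =>
            absurd ⟨x, hx, hxS⟩ hne
          omega) (by
          rintro x ⟨hx, hxS⟩ y ⟨hy, hyS⟩ hxy
          have h1 := mem_interval_of_mem_interval hc (hf x hx).1 (hf y hy).1 hxy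
          by_cases h2 : f x = f y
          · rw [← h2] at h1
            have h3 : f x = ⟨u, self_mem_ball u 2⟩ :=
              Subtype.ext (eq_of_mem_interval_self hc h1)
            exact hcS (h3 ▸ hxS)
          · exact hS.prop hxS hyS h2 ⟨h2, h1⟩)
      have h1 := sum_map_add_mul_weight_le π (fun x => G.dist v x) (fun x => G.dist u x) 1
        (f ⁻¹' S) (f ⁻¹' Sᶜ) (by
          intro x hx
          have h2 := hc.dist_triangle (u := v) (v := u) (w := x)
          rw [G.dist_comm (u := v) (v := u)] at h2
          refine ⟨fun h3 _ => (hv2 x ⟨hx, h3⟩).le, fun _ _ => by omega, fun h3 => ?_⟩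
          exact absurd h3 (by simp))
      have h2 : totalDist G π u ≤ totalDist G π v := hu v
      simp only [totalDist] at h2
      omega
  · obtain ⟨Q, hQ, hQM⟩ := exists_lift_pairing f M (π : Multiset V) hM.isPairing
    refine ⟨Q, hQ, fun a b hab => ?_⟩
    have h1 : s(f a, f b) ∈ M := hQM ▸ Multiset.mem_map_of_mem (Sym2.map f) hab
    have h2 : (localGraph G u).Adj (f a) (f b) := hM.1 _ h1
    exact hfi a (IsPairing.mem_of_mem_pair hQ hab (by simp)) b (IsPairing.mem_of_mem_pair hQ hab (by simp)) h2.2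

/-! ### From perfect pairings to the local condition -/

/-- If a profile in the ball of radius two around `u` does not have `u` as a median, then `u` is
not a median even within this ball. -/
theorem IsBipartiteHelly.exists_totalDist_lt (hG : IsBipartiteHelly G) {u v : V}
    {π : List (ball G u 2)}
    (h : totalDist G (π.map Subtype.val) v < totalDist G (π.map Subtype.val) u) :
    ∃ w, (G.dist u w = 1 ∨ G.dist u w = 2) ∧
      totalDist G (π.map Subtype.val) w < totalDist G (π.map Subtype.val) u := by
  have hc := hG.1
  have hmod := hG.dist_mod_two
  have hle : ∀ a b : V, (∀ x ∈ π, G.dist a x ≤ G.dist b x) →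
      totalDist G (π.map Subtype.val) a ≤ totalDist G (π.map Subtype.val) b := by
    intro a b hab
    rw [totalDist, totalDist, List.map_map, List.map_map]
    exact List.sum_le_sum hab
  by_cases h2 : G.dist u v = 1 ∨ G.dist u v = 2
  · exact ⟨v, h2, h⟩
  -- At distance 3 the entries closer to v never have u between them, so a neighbor of u serves them
  -- all; on the others parity makes v lose at least 1, while that neighbor loses at most 1. At
  -- distance 4 or more, v is nowhere closer than u.
  by_cases h3 : G.dist u v = 3
  · obtain ⟨w, hw1, hw2⟩ := hG.exists_adj_forall (u := u)
      (T := {x | x ∈ π.map Subtype.val ∧ G.dist v x < G.dist u x})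
      ((List.finite_toSet _).subset fun x hx => hx.1) (by
        by_contra hne
        have := hle u v fun x hx => by
          by_contra hlt
          exact hne ⟨x, List.mem_map_of_mem hx, by omega⟩
        omega) (by
        rintro x ⟨-, hx⟩ y ⟨-, hy⟩ hxy
        have h4 := hc.dist_triangle (u := x) (v := v) (w := y)
        simp only [interval, Set.mem_ofPred_eq] at hxy
        rw [G.dist_comm (u := x) (v := v)] at h4
        rw [G.dist_comm (u := x) (v := u)] at hxy
        omega)
    refine ⟨w, Or.inl hw1, lt_of_le_of_lt (hle w v fun x hx => ?_) h⟩
    have hx2 : G.dist u x ≤ 2 := x.2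
    have h5 := hmod u v x
    have h6 := hc.dist_triangle (u := u) (v := x) (w := v)
    have h7 := hc.dist_triangle (u := w) (v := u) (w := x)
    rw [G.dist_comm (u := (x : V)) (v := v)] at h5 h6
    rw [G.dist_comm (u := w) (v := u)] at h7
    by_cases h4 : G.dist v x < G.dist u x
    · have h8 := hw2 x ⟨List.mem_map_of_mem hx, h4⟩
      omega
    · omega
  · exfalso
    have h0 : G.dist u v ≠ 0 := fun h0 => by
      rw [hc.dist_eq_zero_iff] at h0
      subst h0
      omega
    have := hle u v fun x _ => by
      have hx2 : G.dist u x ≤ 2 := x.2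
      have h6 := hc.dist_triangle (u := u) (v := x) (w := v)
      rw [G.dist_comm (u := (x : V)) (v := v)] at h6
      omega
    omega

/-- A perfect pairing of a profile in the ball of radius two around `u` yields the
matching-stable-set condition in the local graph. -/
theorem IsBipartiteHelly.matchingStableSetCondition (hG : IsBipartiteHelly G) {u : V}
    {π : List (ball G u 2)} (h : ∃ P, IsPerfectPairing G (π.map Subtype.val) P) :
    MatchingStableSetCondition (localGraph G u) π := by
  have hc := hG.1
  have hmod := hG.dist_mod_two
  by_cases hmed : ∀ v, totalDist G (π.map Subtype.val) u ≤ totalDist G (π.map Subtype.val) v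
  · obtain ⟨P, hP, v, hv⟩ := h
    have h1 := hP.pairingDist_le hc u
    -- F(u) ≤ F(v) = D(P) ≤ F(u), so u realizes equality as well.
    have hPu := h1.2.1 (by have := hmed v; omega)
    obtain ⟨Q, hQ, rfl⟩ := exists_lift_pairing (fun x : ball G u 2 => (x : V)) P π hP
    by_cases hw : weight π {⟨u, self_mem_ball u 2⟩}ᶜ < weight π {⟨u, self_mem_ball u 2⟩}
    · exact Or.inl ⟨_, by rwa [localGraph_neighborSet_center]⟩
    · refine Or.inr (Or.inr (exists_perfectMatching_of_pairing
        (fun x hx => localGraph_adj_center u hx) (not_lt.1 hw) Q hQ fun e he => ?_))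
      induction e using Sym2.ind with | _ a b
      have hab : u ∈ interval G (a : V) (b : V) :=
        hPu a b (Multiset.mem_map_of_mem (Sym2.map fun x : ball G u 2 => (x : V)) he)
      by_cases heq : a = b
      · subst heq
        have : a = ⟨u, self_mem_ball u 2⟩ := Subtype.ext (eq_of_mem_interval_self hc hab)
        exact Or.inr (by rw [this])
      · exact Or.inl ⟨heq, hab⟩
  · push Not at hmed
    obtain ⟨v, hv⟩ := hmed
    obtain ⟨w, hw, hlt⟩ := hG.exists_totalDist_lt hv
    rw [totalDist, totalDist, List.map_map, List.map_map] at hlt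
    replace hlt : (π.map fun x : ball G u 2 => G.dist w x).sum <
      (π.map fun x : ball G u 2 => G.dist u x).sum := hlt
    rcases hw with hw | hw
    · have hS : Maximal (localGraph G u).IsIndepSet {x | G.dist w x < G.dist u x} := by
        refine ⟨fun x hx y hy _ hxy => ?_, fun T hT hST t ht => ?_⟩
        · have h1 := hc.dist_triangle (u := (x : V)) (v := w) (w := (y : V))
          have h2 : G.dist (x : V) u + G.dist u y = G.dist (x : V) y := hxy.2
          rw [G.dist_comm (u := (x : V)) (v := w)] at h1
          rw [G.dist_comm (u := (x : V)) (v := u)] at h2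
          simp only [Set.mem_ofPred_eq] at hx hy
          omega
        -- Maximality is witnessed by w, which lies in the set: a vertex t outside satisfies d(w,t)
        -- = d(u,t) + 1, so w and t are adjacent.
        · by_contra hn
          simp only [Set.mem_ofPred_eq] at hn
          have hw2 : w ∈ ball G u 2 := by simp [ball, hw]
          have hwS : (⟨w, hw2⟩ : ball G u 2) ∈ {x : ball G u 2 | G.dist w x < G.dist u x} := by
            simp [hw]
          have hne : (⟨w, hw2⟩ : ball G u 2) ≠ t := by
            rintro rfl
            exact hn hwS
          refine hT (hST hwS) ht hne ⟨hne, ?_⟩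
          have h1 := hc.dist_triangle (u := w) (v := u) (w := (t : V))
          have h2 := hmod w t u
          simp only [interval, Set.mem_ofPred_eq]
          rw [G.dist_comm (u := w) (v := u)] at h1 h2 ⊢
          omega
      refine Or.inr (Or.inl ⟨_, hS, ?_⟩)
      rw [neighborhood_eq_compl hS]
      have h1 := sum_map_add_mul_weight_le π (fun x => G.dist u x) (fun x => G.dist w x) 1
        {x | G.dist w x < G.dist u x}ᶜ {x | G.dist w x < G.dist u x} (by
          intro x _
          have h1 := hc.dist_triangle (u := u) (v := w) (w := (x : V))
          have h2 := hmod w x u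
          rw [G.dist_comm (u := w) (v := u)] at h2
          simp only [Set.mem_compl_iff, Set.mem_ofPred_eq]
          refine ⟨fun h3 _ => by omega, fun _ _ => by omega, fun h3 => by omega⟩)
      omega
    · refine Or.inl ⟨⟨w, hw.le⟩, ?_⟩
      -- An x that is neither w nor adjacent to w is no closer to w than to u: d(w,x) is positive
      -- and has the parity of d(u,x) ≤ 2.
      have h1 := sum_map_add_mul_weight_le π (fun x => G.dist u x) (fun x => G.dist w x) 2
        ((localGraph G u).neighborSet ⟨w, hw.le⟩) {⟨w, hw.le⟩} (by
          intro x _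
          have hx2 : G.dist u x ≤ 2 := x.2
          refine ⟨fun h1 _ => ?_, fun _ h1 => by omega, fun h1 => ?_⟩
          · have h2 : G.dist w u + G.dist u x = G.dist w x := h1.2
            rw [G.dist_comm (u := w) (v := u)] at h2
            omega
          · have hne : w ≠ x := by
              intro h2
              have h3 : (localGraph G u).Adj ⟨w, hw.le⟩ x := h1.2 (Subtype.ext h2.symm)
              exact h3.ne (Subtype.ext h2)
            have h4 := hc.pos_dist_of_ne hne
            have h2 := hmod w x u
            rw [G.dist_comm (u := w) (v := u)] at h2
            omega)
      omega

end MedianPairing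

/-! ### The equivalences -/

theorem mainTheorem7 {V : Type*} (G : SimpleGraph V) (hG : MedianPairing.IsBipartiteHelly G) :
    (MedianPairing.PairingProperty G ↔
      ∀ u : V, MedianPairing.MatchingStableSetProperty (MedianPairing.localGraph G u)) ∧
    (MedianPairing.DoublePairingProperty G ↔
      ∀ u : V, MedianPairing.DoubleMatchingStableSetProperty (MedianPairing.localGraph G u)) := by
  refine ⟨⟨fun h u π hπ => ?_, fun h π hπ => ?_⟩, ⟨fun h u τ => ?_, fun h τ => ?_⟩⟩
  · exact hG.matchingStableSetCondition (h _ (by simpa using hπ))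
  · exact hG.exists_perfectPairing hπ fun u f => h u _ (by simpa using hπ)
  · refine hG.matchingStableSetCondition ?_
    rw [List.map_append]
    exact h _
  · refine hG.exists_perfectPairing (by simp) fun u f => ?_
    -- Projecting a double-profile gives a double-profile, so the same argument applies.
    rw [List.map_append]
    exact h u _
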